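/- Let $Q$ be a smooth, second countable (Hausdorff) $n$-dimensional manifold, let ${\rm T}^1_kQ={\rm T}Q\oplus_Q\overset{k}{\cdots}\oplus_Q{\rm T}Q$ with projection $\pi\colon{\rm T}^1_kQ\to Q$, and let $\mathcal L\in{\rm C}^\infty({\rm T}^1_kQ)$ be a Lagrangian function. For $v\in{\rm T}_qQ$ and ${\bf v}=(q;v_1,\ldots,v_k)\in{\rm T}^1_kQ$ put $(v)^{\wedge\alpha}_{\bf v}=\frac{d}{dt}\big|_{t=0}(q;v_1,\ldots,v_\alpha+tv,\ldots,v_k)$, $J^\alpha_{\bf v}({\bf u})=({\rm T}\pi({\bf u}))^{\wedge\alpha}_{\bf v}$ and $\Delta_{\bf v}=\sum_{\alpha}(v_\alpha)^{\wedge\alpha}_{\bf v}$, and let $\omega^\alpha_{\mathcal L}=-{\rm d}\big((J^\alpha)^*{\rm d}\mathcal L\big)$ and $\mathcal E_{\mathcal L}=\Delta(\mathcal L)-\mathcal L$. For a $k$-vector field $\mathbf X=(X_1,\ldots,X_k)\in\mathfrak X^k({\rm T}^1_kQ)$, i.e. a smooth section of ${\rm T}^1_k({\rm T}^1_kQ)\to{\rm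 T}^1_kQ$, let $\mathbf\Omega_{\mathcal L}(\mathbf X)=\sum_{\alpha=1}^k i(X_\alpha)\omega^\alpha_{\mathcal L}$; this is defined pointwise, by linear maps $(\mathbf\Omega_{\mathcal L})_x$ on $k$-tuples of tangent vectors at $x$. For $S\subseteq{\rm T}^1_kQ$, let $\mathfrak X^k_{\mathcal L,\mathcal S}({\rm T}^1_kQ)|_S$ be the set of all $\mathbf X\in\mathfrak X^k({\rm T}^1_kQ)$ that, at every point $x\in S$, satisfy the Lagrangian equation $\mathbf\Omega_{\mathcal L}(\mathbf X)_x=({\rm d}\mathcal E_{\mathcal L})_x$ and are a SOPDE, i.e. ${\rm T}^1_k\pi(\mathbf X(x))=x$. Let $\mathrm{Ker}^V\mathbf\Omega_{\mathcal L}|_S$ be the set of all $\mathbf V\in\mathfrak X^k({\rm T}^1_kQ)$ such that, at every point $x\in S$, $\mathbf\Omega_{\mathcal L}(\mathbf V)_x=0$ and $\mathbf V$ is vertical, i.e. ${\rm T}_x\pi(V_\alpha(x))=0$ for all $\alpha$. Let $P_1=\{x\in{\rm T}^1_kQ\mid({\rm d}\mathcal E_{\mathcal L})_x\in\mathrm{Im}\,(\mathbf\Omega_{\mathcal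 L})_x\}$, let $\mathbf X\in\mathfrak X^k({\rm T}^1_kQ)$ be a solution of the Lagrangian equation at all points of $P_1$, and let $S_1$ be the set of those $x\in P_1$ for which there is a $k$-tuple $(Y_1,\ldots,Y_k)\in\mathrm{Ker}\,(\mathbf\Omega_{\mathcal L})_x$ of tangent vectors at $x$ with $\sum_{\alpha=1}^kJ^\alpha\big(X_\alpha(x)+Y_\alpha\big)=\Delta_x$. If $\mathbf\Gamma\in\mathfrak X^k_{\mathcal L,\mathcal S}({\rm T}^1_kQ)|_{S_1}$, then $$\mathfrak X^k_{\mathcal L,\mathcal S}({\rm T}^1_kQ)|_{S_1}=\big\{\mathbf\Gamma+\mathbf V\ \big|\ \mathbf V\in\mathrm{Ker}^V\mathbf\Omega_{\mathcal L}|_{S_1}\big\}.$$ -/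

import Mathlib

open Bundle Set
open scoped Manifold ContDiff

noncomputable section

/-! ### The `k`-tangent bundle of a manifold -/

section KTangent

variable (k : ℕ) {E H : Type*} [NormedAddCommGroup E] [NormedSpace ℝ E] [TopologicalSpace H]

variable (E) in
/-- A continuous linear endomorphism of `E`, acting on each entry of a `k`-tuple. -/
def kDiagonal : (E →L[ℝ] E) →L[ℝ] ((Fin k → E) →L[ℝ] (Fin k → E)) :=
  LinearMap.mkContinuous
    { toFun := fun f => ContinuousLinearMap.pi fun α : Fin k =>
        f.comp (ContinuousLinearMap.proj α)
      map_add' := fun _ _ => rfl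
      map_smul' := fun _ _ => rfl } 1 (by
    intro f
    refine ContinuousLinearMap.opNorm_le_bound _ (by positivity) fun v => ?_
    refine (pi_norm_le_iff_of_nonneg (by positivity)).2 fun α => ?_
    refine (f.le_opNorm (v α)).trans ?_
    rw [one_mul]
    exact mul_le_mul_of_nonneg_left (norm_le_pi_norm v α) (norm_nonneg f))

variable (I : ModelWithCorners ℝ E H) (M : Type*) [TopologicalSpace M] [ChartedSpace H M]

/-- The cocycle of the Whitney sum of `k` copies of the tangent bundle of `M`: over the
charts of `M`, the transition functions are those of `TM`, acting on each of the `k` entries. -/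
def kTangentCore [IsManifold I ∞ M] : VectorBundleCore ℝ M (Fin k → E) (atlas H M) where
  baseSet := (tangentBundleCore I M).baseSet
  isOpen_baseSet := (tangentBundleCore I M).isOpen_baseSet
  indexAt := (tangentBundleCore I M).indexAt
  mem_baseSet_at := (tangentBundleCore I M).mem_baseSet_at
  coordChange i j x := kDiagonal k E ((tangentBundleCore I M).coordChange i j x)
  coordChange_self i x hx v :=
    funext fun α => (tangentBundleCore I M).coordChange_self i x hx (v α)
  continuousOn_coordChange i j :=
    (kDiagonal k E).continuous.comp_continuousOn
      ((tangentBundleCore I M).continuousOn_coordChange i j)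
  coordChange_comp i j l x hx v :=
    funext fun α => (tangentBundleCore I M).coordChange_comp i j l x hx (v α)

instance kTangentCore_isContMDiff [IsManifold I ∞ M] :
    (kTangentCore k I M).IsContMDiff I ∞ where
  contMDiffOn_coordChange i j := by
    have h : IsManifold I (∞ + 1) M := ‹IsManifold I ∞ M›
    exact (kDiagonal k E).contMDiff.comp_contMDiffOn
      ((tangentBundleCore.isContMDiff (I := I) (M := M) (n := ∞)).contMDiffOn_coordChange i j)

variable {M} in
/-- The fibre of the `k`-tangent bundle at `x`: the `k`-tuples of tangent vectors at `x`. -/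
def KTangentSpace (x : M) : Type _ := Fin k → TangentSpace I x

instance (x : M) : TopologicalSpace (KTangentSpace k I x) :=
  inferInstanceAs (TopologicalSpace (Fin k → TangentSpace I x))

instance (x : M) : AddCommGroup (KTangentSpace k I x) :=
  inferInstanceAs (AddCommGroup (Fin k → TangentSpace I x))

instance (x : M) : Module ℝ (KTangentSpace k I x) :=
  inferInstanceAs (Module ℝ (Fin k → TangentSpace I x))

/-- The `k`-tangent bundle `T¹ₖM = TM ⊕ ⋯ ⊕ TM`; its points are pairs `⟨q, (v₁, …, vₖ)⟩`. -/
abbrev KTangentBundle : Type _ := TotalSpace (Fin k → E) (KTangentSpace k I : M → Type _)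

instance [IsManifold I ∞ M] : TopologicalSpace (KTangentBundle k I M) :=
  inferInstanceAs (TopologicalSpace (kTangentCore k I M).TotalSpace)

instance [IsManifold I ∞ M] : FiberBundle (Fin k → E) (KTangentSpace k I : M → Type _) :=
  inferInstanceAs (FiberBundle (Fin k → E) (kTangentCore k I M).Fiber)

instance [IsManifold I ∞ M] : VectorBundle ℝ (Fin k → E) (KTangentSpace k I : M → Type _) :=
  inferInstanceAs (VectorBundle ℝ (Fin k → E) (kTangentCore k I M).Fiber)

instance [IsManifold I ∞ M] :
    ContMDiffVectorBundle ∞ (Fin k → E) (KTangentSpace k I : M → Type _) I :=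
  inferInstanceAs (ContMDiffVectorBundle ∞ (Fin k → E) (kTangentCore k I M).Fiber I)

/-- The `k`-vector fields on `M`: the smooth sections of `T¹ₖM → M`. -/
abbrev KVectorField [IsManifold I ∞ M] : Type _ :=
  ContMDiffSection I (Fin k → E) ∞ (KTangentSpace k I : M → Type _)

variable {M} {E' H' : Type*} [NormedAddCommGroup E'] [NormedSpace ℝ E'] [TopologicalSpace H']
  (I' : ModelWithCorners ℝ E' H') {M' : Type*} [TopologicalSpace M'] [ChartedSpace H' M']

/-- The `k`-extension `T¹ₖΦ (q; v₁, …, vₖ) = (Φ q; TΦ v₁, …, TΦ vₖ)` of a map `Φ`. -/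
def kExtension (Φ : M → M') (p : KTangentBundle k I M) : KTangentBundle k I' M' :=
  ⟨Φ p.proj, fun α => mfderiv I I' Φ p.proj (p.snd α)⟩

end KTangent

/-! ### Differential forms on a manifold -/

section Forms

variable {E H : Type*} [NormedAddCommGroup E] [NormedSpace ℝ E] [TopologicalSpace H]
  (I : ModelWithCorners ℝ E H) {M : Type*} [TopologicalSpace M] [ChartedSpace H M]

variable (M) in
/-- (Not necessarily smooth) differential `m`-forms on `M`. -/
abbrev DiffForm (m : ℕ) : Type _ := (x : M) → TangentSpace I x [⋀^Fin m]→L[ℝ] ℝ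

/-- The `m`-form `η` in the chart around `x`, i.e. its pullback to the model vector space by
the inverse of that chart. -/
def DiffForm.inChart {m : ℕ} (η : DiffForm I M m) (x : M) : E → E [⋀^Fin m]→L[ℝ] ℝ := fun y =>
  (η ((extChartAt I x).symm y)).compContinuousLinearMap
    (mfderivWithin 𝓘(ℝ, E) I (extChartAt I x).symm (range I) y)

/-- The exterior derivative `dη` of an `m`-form: its value at `x` is the exterior derivative of
`η` in the chart around `x`, pulled back by that chart. -/
def DiffForm.d {m : ℕ} (η : DiffForm I M m) : DiffForm I M (m + 1) := fun x =>
  (extDerivWithin (η.inChart I x) (range I) (extChartAt I x x)).compContinuousLinearMap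
    (mfderiv I 𝓘(ℝ, E) (extChartAt I x) x)

/-- The covector `i(v) η = η(v, ·)`, for a `2`-covector `η` and a vector `v`. -/
def interiorProduct {T : Type*} [AddCommGroup T] [Module ℝ T] [TopologicalSpace T]
    (η : T [⋀^Fin 2]→L[ℝ] ℝ) (v : T) : T →L[ℝ] ℝ :=
  η.toContinuousMultilinearMap.toContinuousLinearMap ![v, 0] 1

theorem interiorProduct_apply {T : Type*} [AddCommGroup T] [Module ℝ T] [TopologicalSpace T]
    (η : T [⋀^Fin 2]→L[ℝ] ℝ) (v u : T) : interiorProduct η v u = η ![v, u] := by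
  have h : Function.update ![v, 0] 1 u = ![v, u] := by
    ext i; fin_cases i <;> rfl
  exact congrArg η h

end Forms

/-! ### Lagrangian `k`-vector fields on `T¹ₖQ` -/

namespace KLagrangian

variable {n k : ℕ} {Q : Type*} [TopologicalSpace Q] [ChartedSpace (EuclideanSpace ℝ (Fin n)) Q]

variable (n k Q) in
/-- The manifold `T¹ₖQ`, for an `n`-dimensional manifold `Q`. -/
abbrev TQ : Type _ := KTangentBundle k (𝓡 n) Q

variable (n k) in
/-- The model of the manifold `T¹ₖQ`. -/
abbrev model : ModelWithCorners ℝ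
    (EuclideanSpace ℝ (Fin n) × (Fin k → EuclideanSpace ℝ (Fin n)))
    (ModelProd (EuclideanSpace ℝ (Fin n)) (Fin k → EuclideanSpace ℝ (Fin n))) :=
  (𝓡 n).prod 𝓘(ℝ, Fin k → EuclideanSpace ℝ (Fin n))

variable [IsManifold (𝓡 n) ∞ Q]

/-- The projection `π : T¹ₖQ → Q`. -/
def proj (v : TQ n k Q) : Q := v.proj

/-- The tangent map `T_v π : T_v(T¹ₖQ) → T_{π v} Q`. -/
def tangentProj (v : TQ n k Q) :
    TangentSpace (model n k) v →L[ℝ] TangentSpace (𝓡 n) v.proj :=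
  mfderiv (model n k) (𝓡 n) (proj : TQ n k Q → Q) v

/-- The inclusion of the fibre of `T¹ₖQ` over `q`. -/
def fibreInclusion (q : Q) (w : Fin k → EuclideanSpace ℝ (Fin n)) : TQ n k Q := ⟨q, w⟩

/-- The `k` velocities `(v₁, …, vₖ)` of a point of `T¹ₖQ`, as an element of the model fibre. -/
def velocities (v : TQ n k Q) : Fin k → EuclideanSpace ℝ (Fin n) := v.snd

/-- The vertical `α`-lift from `T_{π v} Q` to `T_v(T¹ₖQ)`: the derivative at `v` of the inclusion
of the fibre through `v`, in the direction of its `α`-th summand. See `verticalLift_eq_curve`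
for its description by curves. -/
def verticalLift (α : Fin k) (v : TQ n k Q) :
    TangentSpace (𝓡 n) v.proj →L[ℝ] TangentSpace (model n k) v :=
  (mfderiv 𝓘(ℝ, Fin k → EuclideanSpace ℝ (Fin n)) (model n k) (fibreInclusion v.proj)
    (velocities v)).comp
    (ContinuousLinearMap.single ℝ (fun _ : Fin k => EuclideanSpace ℝ (Fin n)) α)

theorem contMDiff_fibreInclusion (q : Q) :
    ContMDiff 𝓘(ℝ, Fin k → EuclideanSpace ℝ (Fin n)) (model n k) ∞
      (fibreInclusion q : _ → TQ n k Q) := by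
  intro w
  rw [Bundle.contMDiffAt_totalSpace]
  refine ⟨contMDiffAt_const, contMDiffAt_id.congr_of_eventuallyEq (.of_forall fun x => ?_)⟩
  exact (kTangentCore k (𝓡 n) Q).coordChange_self (achart _ q) q (mem_chart_source _ q) x

/-- The vertical `α`-lift of `w` is the velocity at `t = 0` of the curve
`t ↦ (q; v₁, …, v_α + t w, …, vₖ)`. -/
theorem verticalLift_eq_curve (α : Fin k) (v : TQ n k Q) (w : EuclideanSpace ℝ (Fin n)) :
    verticalLift α v w = mfderiv 𝓘(ℝ, ℝ) (model n k)
      (fun t : ℝ => (fibreInclusion v.proj (velocities v + t • (Pi.single α w : Fin k → EuclideanSpace ℝ (Fin n))) : TQ n k Q))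
      0 (1 : ℝ) := by
  have hc : HasDerivAt (fun t : ℝ => velocities v + t • (Pi.single α w : Fin k → EuclideanSpace ℝ (Fin n))) (Pi.single α w) 0 := by
    simpa using ((hasDerivAt_id (0 : ℝ)).smul_const (Pi.single α w)).const_add (velocities v)
  have h := mfderiv_comp_of_eq (I := 𝓘(ℝ, ℝ)) (x := (0 : ℝ))
    (((contMDiff_fibreInclusion v.proj).mdifferentiable (by simp)) (velocities v))
    hc.differentiableAt.mdifferentiableAt (by simp)
  refine Eq.trans ?_ (DFunLike.congr_fun h (1 : ℝ)).symm
  have h1 : mfderiv 𝓘(ℝ, ℝ) 𝓘(ℝ, Fin k → EuclideanSpace ℝ (Fin n))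
      (fun t : ℝ => velocities v + t • (Pi.single α w : Fin k → EuclideanSpace ℝ (Fin n))) 0 (1 : ℝ) = Pi.single α w := by
    rw [mfderiv_eq_fderiv]
    exact hc.deriv
  have h2 : ∀ y, y = velocities v → ∀ z : Fin k → EuclideanSpace ℝ (Fin n), z = Pi.single α w →
      verticalLift α v w = mfderiv 𝓘(ℝ, Fin k → EuclideanSpace ℝ (Fin n)) (model n k)
        (fibreInclusion v.proj : _ → TQ n k Q) y z := by
    rintro _ rfl _ rfl
    rfl
  exact h2 _ (by simp) _ h1

/-- The vertical endomorphisms `J^α` of `T¹ₖQ`. -/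
def J (α : Fin k) (v : TQ n k Q) :
    TangentSpace (model n k) v →L[ℝ] TangentSpace (model n k) v :=
  (verticalLift α v).comp (tangentProj v)

/-- The Liouville vector field `Δ` of `T¹ₖQ`. -/
def liouville (v : TQ n k Q) : TangentSpace (model n k) v :=
  ∑ α : Fin k, verticalLift α v (v.snd α)

/-- The Cartan `1`-forms `θ^α = (J^α)^* dL`, as families of covectors. -/
def cartanCovector (L : TQ n k Q → ℝ) (α : Fin k) (v : TQ n k Q) :
    TangentSpace (model n k) v →L[ℝ] ℝ :=
  (mvfderiv (model n k) L v).comp (J α v)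

/-- The Cartan `1`-forms `θ^α = (J^α)^* dL`. -/
def cartanOneForm (L : TQ n k Q → ℝ) (α : Fin k) : DiffForm (model n k) (TQ n k Q) 1 := fun v =>
  ContinuousAlternatingMap.ofSubsingleton ℝ (TangentSpace (model n k) v) ℝ (0 : Fin 1)
    (cartanCovector L α v)

/-- The Cartan `2`-forms `ω^α = -dθ^α`. -/
def cartanTwoForm (L : TQ n k Q → ℝ) (α : Fin k) : DiffForm (model n k) (TQ n k Q) 2 :=
  -(cartanOneForm L α).d

/-- The Lagrangian energy `E_L = Δ(L) - L`. -/
def energy (L : TQ n k Q → ℝ) (v : TQ n k Q) : ℝ :=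
  mvfderiv (model n k) L v (liouville v) - L v

/-- `Ω_L(X₁, …, Xₖ) = ∑ α, i(X_α) ω^α` at a point `v`. -/
def Omega (L : TQ n k Q → ℝ) (v : TQ n k Q) (X : KTangentSpace k (model n k) v) :
    TangentSpace (model n k) v →L[ℝ] ℝ :=
  ∑ α : Fin k, interiorProduct (cartanTwoForm L α v) (X α)

/-- The `k`-vector fields on `T¹ₖQ` that satisfy the Lagrangian equation `Ω_L(X) = dE_L` at the
points of `S`. -/
def lagrangianOn (L : TQ n k Q → ℝ) (S : Set (TQ n k Q)) :
    Set (KVectorField k (model n k) (TQ n k Q)) :=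
  {X | ∀ v ∈ S, Omega L v (X v) = mvfderiv (model n k) (energy L) v}

/-- The `k`-vector fields on `T¹ₖQ` that are SOPDEs at the points of `S`, i.e. that are there
sections of `T¹ₖπ : T¹ₖ(T¹ₖQ) → T¹ₖQ`. -/
def sopdeOn (S : Set (TQ n k Q)) : Set (KVectorField k (model n k) (TQ n k Q)) :=
  {X | ∀ v ∈ S, kExtension k (model n k) (𝓡 n) proj (⟨v, X v⟩ : KTangentBundle _ _ _) = v}

/-- The SOPDE solutions of the Lagrangian equation on `S`. -/
def lagrangianSopdeOn (L : TQ n k Q → ℝ) (S : Set (TQ n k Q)) :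
    Set (KVectorField k (model n k) (TQ n k Q)) :=
  lagrangianOn L S ∩ sopdeOn S

/-- The `k`-vector fields on `T¹ₖQ` that lie in `Ker Ω_L` at the points of `S`. -/
def kerOmegaOn (L : TQ n k Q → ℝ) (S : Set (TQ n k Q)) :
    Set (KVectorField k (model n k) (TQ n k Q)) :=
  {V | ∀ v ∈ S, Omega L v (V v) = 0}

/-- The `k`-vector fields on `T¹ₖQ` that are `π`-vertical at the points of `S`. -/
def verticalOn (S : Set (TQ n k Q)) : Set (KVectorField k (model n k) (TQ n k Q)) :=
  {V | ∀ v ∈ S, ∀ α : Fin k, tangentProj v (V v α) = 0}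

/-- `Ker^V Ω_L` on `S`: the `π`-vertical `k`-vector fields in the kernel of `Ω_L`. -/
def kerVerticalOn (L : TQ n k Q → ℝ) (S : Set (TQ n k Q)) :
    Set (KVectorField k (model n k) (TQ n k Q)) :=
  kerOmegaOn L S ∩ verticalOn S

/-- `P₁`: the points of `T¹ₖQ` at which the Lagrangian equation is solvable. -/
def P₁ (L : TQ n k Q → ℝ) : Set (TQ n k Q) :=
  {v | mvfderiv (model n k) (energy L) v ∈ Set.range (Omega L v)}

/-- `S₁`, for a solution `X` of the Lagrangian equation on `P₁`: the points of `P₁` at which an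
element of `Ker Ω_L` can be added to `X` so that the SOPDE condition `∑ α, J^α (X_α + Y_α) = Δ`
holds there. -/
def S₁ (L : TQ n k Q → ℝ) (X : KVectorField k (model n k) (TQ n k Q)) : Set (TQ n k Q) :=
  {v | v ∈ P₁ L ∧ ∃ Y : KTangentSpace k (model n k) v,
    Omega L v Y = 0 ∧ ∑ α : Fin k, J α v (X v α + Y α) = liouville v}

end KLagrangian

end

open KLagrangian

namespace KLagrangian

variable {n k : ℕ} {Q : Type*} [TopologicalSpace Q] [ChartedSpace (EuclideanSpace ℝ (Fin n)) Q]
  [IsManifold (𝓡 n) ∞ Q]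

/-! The SOPDE solutions on a set form an affine space, because both defining conditions are
inhomogeneous linear equations at each point. The Lagrangian equation is `Ω_L(X) = dE_L` with `Ω_L`
additive in `X` (`Omega_add`). The SOPDE condition amounts to `Tπ(X_α) = v_α` for all `α`, with `Tπ`
linear (`mem_sopdeOn_iff`). Given the particular solution `Γ`, the sum `Γ + V` is a solution exactly
when `V` solves the two homogeneous equations, `Ω_L(V) = 0` and `Tπ(V_α) = 0`, which define `Ker^V
Ω_L`. This is `add_mem_lagrangianSopdeOn_iff`, valid over any subset `S`; the theorem is the case `S
= S₁`. -/

theorem Omega_add (L : TQ n k Q → ℝ) (v : TQ n k Q) (X Y : KTangentSpace k (model n k) v) :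
    Omega L v (X + Y) = Omega L v X + Omega L v Y := by
  refine ContinuousLinearMap.ext fun u => ?_
  simp only [Omega, _root_.add_apply, _root_.sum_apply,
    ← Finset.sum_add_distrib]
  refine Finset.sum_congr rfl fun α _ => ?_
  rw [interiorProduct_apply, interiorProduct_apply, interiorProduct_apply]
  -- Sums in `KTangentSpace` are entrywise by definition, so what remains is additivity of the
  -- `2`-form in its first argument.
  exact (cartanTwoForm L α v).toMultilinearMap.cons_add ![u] (X α) (Y α)

/-- A `k`-vector field is a SOPDE at `v` if and only if its components project to the velocities
of `v`. -/
theorem mem_sopdeOn_iff (S : Set (TQ n k Q)) (X : KVectorField k (model n k) (TQ n k Q)) :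
    X ∈ sopdeOn S ↔ ∀ v ∈ S, ∀ α : Fin k, tangentProj v (X v α) = v.snd α := by
  refine forall₂_congr fun v _ => ?_
  obtain ⟨q, w⟩ := v
  constructor
  · intro h α
    -- With the point split as `⟨q, w⟩`, both sides lie over `q` by definition, so the heterogeneous
    -- equality of fibre parts is an honest equality of `k`-tuples.
    exact congrFun (eq_of_heq (TotalSpace.mk.inj h).2) α
  · intro h
    exact congrArg (TotalSpace.mk q) (funext h)

/-- Adding `V` to a SOPDE solution of the Lagrangian equation on `S` gives another one if and only
if `V` is vertical and lies in the kernel of `Ω_L` on `S`. -/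
theorem add_mem_lagrangianSopdeOn_iff {L : TQ n k Q → ℝ} {S : Set (TQ n k Q)}
    {Γ : KVectorField k (model n k) (TQ n k Q)} (hΓ : Γ ∈ lagrangianSopdeOn L S)
    (V : KVectorField k (model n k) (TQ n k Q)) :
    Γ + V ∈ lagrangianSopdeOn L S ↔ V ∈ kerVerticalOn L S := by
  have hΓ' := (mem_sopdeOn_iff S Γ).1 hΓ.2
  refine and_congr (forall₂_congr fun v hv => ?_) ((mem_sopdeOn_iff S _).trans
    (forall₂_congr fun v hv => forall_congr' fun α => ?_))
  -- The equation becomes `dE_L + Ω_L(V) = dE_L`, that is, `Ω_L(V) = 0`.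
  · rw [ContMDiffSection.coe_add, Pi.add_apply, Omega_add, hΓ.1 v hv, add_eq_left]
  · have h : tangentProj v ((Γ + V) v α) = tangentProj v (Γ v α) + tangentProj v (V v α) :=
      (tangentProj v).map_add (Γ v α) (V v α)
    -- Likewise `v_α + Tπ(V_α) = v_α` says that `V_α` is vertical.
    rw [h, hΓ' v hv α, add_eq_left]

end KLagrangian

theorem mainTheorem3 (n k : ℕ) (Q : Type*) [TopologicalSpace Q] [T2Space Q]
    [SecondCountableTopology Q] [ChartedSpace (EuclideanSpace ℝ (Fin n)) Q]
    [IsManifold (𝓡 n) ∞ Q]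
    (L : TQ n k Q → ℝ) (hL : ContMDiff (model n k) 𝓘(ℝ, ℝ) ∞ L)
    (X : KVectorField k (model n k) (TQ n k Q)) (hX : X ∈ lagrangianOn L (P₁ L))
    (Γ : KVectorField k (model n k) (TQ n k Q)) (hΓ : Γ ∈ lagrangianSopdeOn L (S₁ L X)) :
    lagrangianSopdeOn L (S₁ L X) = {Γ' | ∃ V ∈ kerVerticalOn L (S₁ L X), Γ' = Γ + V} := by
  ext Γ'
  constructor
  · intro h
    -- The difference of two smooth sections is again a smooth section on all of `T¹ₖQ`, so it is an
    -- admissible `V`.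
    refine ⟨Γ' - Γ, (add_mem_lagrangianSopdeOn_iff hΓ _).1 ?_, (add_sub_cancel Γ Γ').symm⟩
    rwa [add_sub_cancel]
  · rintro ⟨V, hV, rfl⟩
    exact (add_mem_lagrangianSopdeOn_iff hΓ V).2 hV
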